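/- Let $K$ be a field and let $A$ be a finite-dimensional $K$-algebra that is a Nakayama algebra, i.e. every finitely generated indecomposable left or right $A$-module is uniserial (has a unique composition series). Assume that $A$ is Auslander–Gorenstein: $\operatorname{idim}(A_A)<\infty$, and for every $n\ge 1$ the terms of a minimal injective coresolution $0\to A_A\to I^0\to I^1\to I^2\to\cdots$ satisfy $\operatorname{pdim} I^i\le i$ for all $0\le i<n$. For a right $A$-module $M$ put $\operatorname{grade} M=\inf\{i\ge 0 \mid \operatorname{Ext}^i_A(M,A)\ne 0\}$, and call $M$ perfect if $\operatorname{grade} M=\operatorname{pdim} M$. Then for every simple right $A$-module $S$ whose injective envelope $I(S)$ has (finite) odd projective dimension, we have $\operatorname{pdim} I(S)=\operatorname{pdim} S$ and $S$ is perfect; that is, $\operatorname{pdim} I(S)=\operatorname{pdim} S=\operatorname{grade} S$. -/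

import Mathlib

open CategoryTheory

universe u

/-- A module is uniserial if its submodules form a chain. For modules of finite length this says
that the module has a unique composition series. -/
def IsUniserialModule (R : Type u) [Ring R] (M : Type u) [AddCommGroup M] [Module R M] : Prop :=
  ∀ N P : Submodule R M, N ≤ P ∨ P ≤ N

/-- Every finitely generated indecomposable left module and every finitely generated indecomposable
right module is uniserial. Right `A`-modules are modules over `Aᵐᵒᵖ`. For a finite-dimensional
algebra `A` this says that `A` is a Nakayama algebra. -/
structure IsNakayama (A : Type u) [Ring A] : Prop where
  left : ∀ (M : Type u) [AddCommGroup M] [Module A M] [Module.Finite A M],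
    Indecomposable (ModuleCat.of A M) → IsUniserialModule A M
  right : ∀ (M : Type u) [AddCommGroup M] [Module Aᵐᵒᵖ M] [Module.Finite Aᵐᵒᵖ M],
    Indecomposable (ModuleCat.of Aᵐᵒᵖ M) → IsUniserialModule Aᵐᵒᵖ M

/-- A submodule is essential if it meets every nonzero submodule nontrivially. -/
def IsEssentialSubmodule {R : Type u} [Ring R] {M : Type u} [AddCommGroup M] [Module R M]
    (N : Submodule R M) : Prop :=
  ∀ P : Submodule R M, N ⊓ P = ⊥ → P = ⊥

/-- `ι : M ⟶ I` is an injective envelope of `M`. -/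
structure IsInjectiveEnvelope {R : Type u} [Ring R] {M I : ModuleCat.{u} R} (ι : M ⟶ I) :
    Prop where
  injective : Injective I
  mono : Mono ι
  essential : IsEssentialSubmodule (LinearMap.range ι.hom)

/-- An injective coresolution `0 ⟶ M ⟶ I⁰ ⟶ I¹ ⟶ ⋯` is minimal if `I⁰` is an injective envelope of
`M` and each `Iⁿ⁺¹` is an injective envelope of the image of `Iⁿ ⟶ Iⁿ⁺¹`. -/
structure IsMinimalInjectiveResolution {R : Type u} [Ring R] {M : ModuleCat.{u} R}
    (I : InjectiveResolution M) : Prop where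
  essential_zero : IsEssentialSubmodule (LinearMap.range (I.ι.f 0).hom)
  essential_succ : ∀ n : ℕ,
    IsEssentialSubmodule (LinearMap.range (I.cocomplex.d n (n + 1)).hom)

/-- The regular right module `A_A`. -/
abbrev regularRightModule (A : Type u) [Ring A] : ModuleCat.{u} Aᵐᵒᵖ :=
  ModuleCat.of Aᵐᵒᵖ A

/-- `A` is `n`-Gorenstein: in a minimal injective coresolution of `A_A` one has
`pdim Iⁱ ≤ i` for all `i < n`. (Minimal injective coresolutions exist and are unique up to
isomorphism.) -/
def IsNGorenstein (A : Type u) [Ring A] (n : ℕ) : Prop :=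
  ∃ I : InjectiveResolution (regularRightModule A), IsMinimalInjectiveResolution I ∧
    ∀ i : ℕ, i < n → projectiveDimension (I.cocomplex.X i) ≤ (i : WithBot ℕ∞)

/-- `A` is Auslander–Gorenstein: `idim A_A < ∞` and `A` is `n`-Gorenstein for all `n ≥ 1`. -/
structure IsAuslanderGorenstein (A : Type u) [Ring A] : Prop where
  injectiveDimension_lt_top : injectiveDimension (regularRightModule A) < ⊤
  isNGorenstein : ∀ n : ℕ, 1 ≤ n → IsNGorenstein A n

/-- `grade M = inf {i ≥ 0 | Extⁱ_A(M, A) ≠ 0}`, with value `⊤` if there is no such `i`. -/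
noncomputable def moduleGrade {A : Type u} [Ring A] (M : ModuleCat.{u} Aᵐᵒᵖ) : ℕ∞ :=
  ⨅ (i : ℕ) (_ : Nontrivial (Abelian.Ext M (regularRightModule A) i)), (i : ℕ∞)

/-- `M` is perfect if `grade M = pdim M`. -/
def IsPerfectModule {A : Type u} [Ring A] (M : ModuleCat.{u} Aᵐᵒᵖ) : Prop :=
  (moduleGrade M : WithBot ℕ∞) = projectiveDimension M

open Function

variable {R : Type u} [Ring R]

/-! ### Uniserial modules and their uniserial projective covers -/

section Uniserial

variable {M N : Type u} [AddCommGroup M] [Module R M] [AddCommGroup N] [Module R N]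

/-! Let `d = 2k + 1` be the projective dimension of `I = I(S)`. If `Extⁱ(S, A) ≠ 0`, then `I` is a
summand of the `i`-th term of the coresolution, so `d ≤ i` by the Auslander condition; hence `d ≤
grade S`. Conversely, `I` is uniserial and contains `S`. Passing to syzygies turns an inclusion of
uniserial modules into a surjection, and a second time into an inclusion. Since `d` is odd, this
descends to projective dimension 1, where a uniserial syzygy maps onto a nonzero projective and must
be isomorphic to it; so `pdim S ≤ d`. Finally, finite projective dimension is detected by `Ext` into
`A`, so `pdim S < d` would force `S = 0`, and `Ext` in degree `d` is nonzero. -/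

theorem IsUniserialModule.of_injective (hN : IsUniserialModule R N) (f : M →ₗ[R] N)
    (hf : Injective f) : IsUniserialModule R M := fun P Q =>
  (hN (P.map f) (Q.map f)).imp (Submodule.map_le_map_iff_of_injective hf _ _).1
    (Submodule.map_le_map_iff_of_injective hf _ _).1

theorem IsUniserialModule.submodule (hM : IsUniserialModule R M) (P : Submodule R M) :
    IsUniserialModule R P :=
  hM.of_injective P.subtype P.subtype_injective

/-- A surjection from a uniserial module onto a nonzero projective module is injective. -/
theorem IsUniserialModule.injective_of_surjective_of_projective (hM : IsUniserialModule R M)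
    [Module.Projective R N] [Nontrivial N] (f : M →ₗ[R] N) (hf : Surjective f) : Injective f := by
  obtain ⟨s, hs⟩ := Module.projective_lifting_property f LinearMap.id hf
  have hs' (x : N) : f (s x) = x := LinearMap.congr_fun hs x
  rw [← LinearMap.ker_eq_bot, eq_bot_iff]
  -- The kernel and the image of the section are complementary, yet comparable.
  rcases hM (LinearMap.ker f) (LinearMap.range s) with h | h
  · intro x hx
    obtain ⟨y, rfl⟩ := h hx
    rw [LinearMap.mem_ker, hs'] at hx
    simp [hx]
  · obtain ⟨x, hx⟩ := exists_ne (0 : N)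
    exact absurd ((hs' x).symm.trans (h ⟨x, rfl⟩)) hx

/-- A uniserial quotient of a finitely generated projective module over an artinian ring is a
quotient of a finitely generated uniserial projective module, provided that finitely generated
indecomposable modules are uniserial. -/
theorem exists_uniserial_projective_of_surjective [IsArtinianRing R] [IsNoetherianRing R]
    (hR : ∀ (M : Type u) [AddCommGroup M] [Module R M] [Module.Finite R M],
      Indecomposable (ModuleCat.of R M) → IsUniserialModule R M)
    (hM : IsUniserialModule R M) (n : ℕ) (P : Type u) [AddCommGroup P] [Module R P]
    [Module.Finite R P] [Module.Projective R P] (hn : Module.length R P ≤ n)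
    (f : P →ₗ[R] M) (hf : Surjective f) :
    ∃ (Q : Type u) (_ : AddCommGroup Q) (_ : Module R Q), Module.Finite R Q ∧
      Module.Projective R Q ∧ IsUniserialModule R Q ∧ ∃ g : Q →ₗ[R] M, Surjective g := by
  induction n generalizing P with
  | zero =>
    have : Subsingleton P := Module.length_eq_zero_iff.1 (by simpa using hn)
    exact ⟨P, _, _, ‹_›, ‹_›, fun _ _ => .inl (Subsingleton.elim _ _).le, f, hf⟩
  | succ n ih =>
    by_cases hP : Indecomposable (ModuleCat.of R P)
    · exact ⟨P, _, _, ‹_›, ‹_›, hR P hP, f, hf⟩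
    by_cases hP0 : Limits.IsZero (ModuleCat.of R P)
    · have : Subsingleton P := ModuleCat.isZero_iff_subsingleton.1 hP0
      exact ⟨P, _, _, ‹_›, ‹_›, fun _ _ => .inl (Subsingleton.elim _ _).le, f, hf⟩
    simp only [Indecomposable, not_and, not_forall, not_or] at hP
    obtain ⟨Y, Z, i, hY, hZ⟩ := hP hP0
    let e : P ≃ₗ[R] Y × Z := (i ≪≫ ModuleCat.biprodIsoProd Y Z).toLinearEquiv
    rw [ModuleCat.isZero_iff_subsingleton, not_subsingleton_iff_nontrivial] at hY hZ
    have : Module.Finite R (Y × Z) := .equiv e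
    have : Module.Projective R (Y × Z) := .of_equiv e
    have : Module.Finite R Y := .of_surjective (LinearMap.fst R Y Z) LinearMap.fst_surjective
    have : Module.Finite R Z := .of_surjective (LinearMap.snd R Y Z) LinearMap.snd_surjective
    have : Module.Projective R Y :=
      .of_split (LinearMap.inl R Y Z) (LinearMap.fst R Y Z) (LinearMap.fst_comp_inl R Y Z)
    have : Module.Projective R Z :=
      .of_split (LinearMap.inr R Y Z) (LinearMap.snd R Y Z) (LinearMap.snd_comp_inr R Y Z)
    have hl : Module.length R Y + Module.length R Z ≤ n + 1 := by
      rw [← Module.length_prod, ← e.length_eq]; exact_mod_cast hn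
    have hlY : 1 ≤ Module.length R Y := Order.one_le_iff_pos.2 Module.length_pos
    have hlZ : 1 ≤ Module.length R Z := Order.one_le_iff_pos.2 Module.length_pos
    let a : Y →ₗ[R] M := f ∘ₗ e.symm.toLinearMap ∘ₗ LinearMap.inl R Y Z
    let b : Z →ₗ[R] M := f ∘ₗ e.symm.toLinearMap ∘ₗ LinearMap.inr R Y Z
    have hab : LinearMap.range a ⊔ LinearMap.range b = ⊤ := by
      rw [eq_top_iff]
      intro x _
      obtain ⟨p, rfl⟩ := hf x
      obtain ⟨⟨y, z⟩, rfl⟩ := e.symm.surjective p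
      refine Submodule.mem_sup.2 ⟨a y, ⟨y, rfl⟩, b z, ⟨z, rfl⟩, ?_⟩
      simp only [a, b, LinearMap.comp_apply, ← map_add]
      simp
    -- The two images are comparable and span `M`, so one summand alone already covers `M`.
    rcases hM (LinearMap.range a) (LinearMap.range b) with h | h
    · rw [sup_eq_right.2 h] at hab
      refine ih Z ?_ b (LinearMap.range_eq_top.1 hab)
      exact (ENat.add_le_add_iff_right ENat.one_ne_top).1
        ((add_comm _ _).trans_le ((add_le_add_left hlY _).trans hl))
    · rw [sup_eq_left.2 h] at hab
      refine ih Y ?_ a (LinearMap.range_eq_top.1 hab)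
      exact (ENat.add_le_add_iff_right ENat.one_ne_top).1 ((add_le_add_right hlZ _).trans hl)

theorem exists_uniserial_projective [IsArtinianRing R] [IsNoetherianRing R]
    (hR : ∀ (M : Type u) [AddCommGroup M] [Module R M] [Module.Finite R M],
      Indecomposable (ModuleCat.of R M) → IsUniserialModule R M)
    (hM : IsUniserialModule R M) [Module.Finite R M] :
    ∃ (Q : Type u) (_ : AddCommGroup Q) (_ : Module R Q), Module.Finite R Q ∧
      Module.Projective R Q ∧ IsUniserialModule R Q ∧ ∃ g : Q →ₗ[R] M, Surjective g := by
  obtain ⟨n, f, hf⟩ := Module.Finite.exists_fin' R M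
  obtain ⟨l, hl⟩ := ENat.ne_top_iff_exists.1 (Module.length_ne_top (R := R) (M := Fin n → R))
  exact exists_uniserial_projective_of_surjective hR hM l (Fin n → R) hl.ge f hf

end Uniserial

/-! ### Syzygies and projective dimension of submodules -/

section ProjectiveDimension

theorem hasProjectiveDimensionLT_iff_ker {P M : Type u} [AddCommGroup P] [Module R P]
    [AddCommGroup M] [Module R M] [Module.Projective R P] (f : P →ₗ[R] M) (hf : Surjective f)
    (n : ℕ) : HasProjectiveDimensionLT (ModuleCat.of R M) (n + 2) ↔
      HasProjectiveDimensionLT (ModuleCat.of R (LinearMap.ker f)) (n + 1) :=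
  (LinearMap.shortExact_shortComplexKer hf).hasProjectiveDimensionLT_X₃_iff n
    ((IsProjective.iff_projective P).1 ‹_›)

theorem nontrivial_ker_of_not_projective {P M : Type u} [AddCommGroup P] [Module R P]
    [AddCommGroup M] [Module R M] [Module.Projective R P] (f : P →ₗ[R] M) (hf : Surjective f)
    (hM : ¬ Module.Projective R M) : Nontrivial (LinearMap.ker f) := by
  rw [Submodule.nontrivial_iff_ne_bot]
  intro h
  exact hM (.of_equiv (LinearEquiv.ofBijective f ⟨LinearMap.ker_eq_bot.1 h, hf⟩))

/-- A submodule `U` of a quotient of a uniserial module `P` by a submodule `K` is a quotient of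
a uniserial projective module such that the kernel maps onto `K`. -/
theorem exists_cover_ker [IsArtinianRing R] [IsNoetherianRing R]
    (hR : ∀ (M : Type u) [AddCommGroup M] [Module R M] [Module.Finite R M],
      Indecomposable (ModuleCat.of R M) → IsUniserialModule R M)
    {P M U : Type u} [AddCommGroup P] [Module R P] [AddCommGroup M] [Module R M]
    [AddCommGroup U] [Module R U] [Module.Finite R P] (hP : IsUniserialModule R P)
    (p : P →ₗ[R] M) (hp : Surjective p) (f : U →ₗ[R] M) (hf : Injective f) :
    ∃ (Q : Type u) (_ : AddCommGroup Q) (_ : Module R Q), Module.Finite R Q ∧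
      Module.Projective R Q ∧ IsUniserialModule R Q ∧ ∃ q : Q →ₗ[R] U, Surjective q ∧
        ∃ t : LinearMap.ker q →ₗ[R] LinearMap.ker p, Surjective t := by
  -- Cover the preimage of `U` in `P`. It contains `ker p`, so `v` maps `ker q = v⁻¹(ker p)` onto
  -- `ker p`.
  obtain ⟨Q, _, _, _, _, hQ, v, hv⟩ :=
    exists_uniserial_projective hR (hP.submodule ((LinearMap.range f).comap p))
  let e := LinearEquiv.ofInjective f hf
  let q : Q →ₗ[R] U := e.symm.toLinearMap ∘ₗ
    (p.restrict (p := (LinearMap.range f).comap p) fun _ h => h) ∘ₗ v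
  have hq (x : Q) : f (q x) = p (v x) := congr_arg Subtype.val (e.apply_symm_apply _)
  refine ⟨Q, _, _, ‹_›, ‹_›, hQ, q, fun u => ?_,
    (((LinearMap.range f).comap p).subtype ∘ₗ v ∘ₗ q.ker.subtype).codRestrict _ fun x => ?_,
    fun x => ?_⟩
  · obtain ⟨y, hy⟩ := hp (f u)
    obtain ⟨x, hx⟩ := hv ⟨y, u, hy.symm⟩
    exact ⟨x, hf (by rw [hq, hx, hy])⟩
  · have h := hq x
    rw [LinearMap.mem_ker.1 x.2, map_zero] at h
    exact h.symm
  · obtain ⟨y, hy⟩ := hv ⟨x, 0, by rw [map_zero, LinearMap.mem_ker.1 x.2]⟩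
    have hyx : (v y : P) = x := congr_arg Subtype.val hy
    refine ⟨⟨y, hf ?_⟩, Subtype.ext hyx⟩
    rw [hq, hyx, map_zero]
    exact x.2

/-- If a finitely generated uniserial module has odd projective dimension `2k + 1`, then its
submodules have projective dimension at most `2k + 1`. -/
theorem IsUniserialModule.hasProjectiveDimensionLT_of_injective [IsArtinianRing R]
    [IsNoetherianRing R]
    (hR : ∀ (M : Type u) [AddCommGroup M] [Module R M] [Module.Finite R M],
      Indecomposable (ModuleCat.of R M) → IsUniserialModule R M) (k : ℕ)
    {M U : Type u} [AddCommGroup M] [Module R M] [AddCommGroup U] [Module R U]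
    [Module.Finite R M] (hM : IsUniserialModule R M) (f : U →ₗ[R] M) (hf : Injective f)
    (h₂ : HasProjectiveDimensionLT (ModuleCat.of R M) (2 * k + 2))
    (h₁ : ¬ HasProjectiveDimensionLT (ModuleCat.of R M) (2 * k + 1)) :
    HasProjectiveDimensionLT (ModuleCat.of R U) (2 * k + 2) := by
  induction k generalizing M U with
  | zero =>
    obtain ⟨P, _, _, _, _, hP, p, hp⟩ := exists_uniserial_projective hR hM
    obtain ⟨Q, _, _, _, _, hQ, q, hq, t, ht⟩ := exists_cover_ker hR hP p hp f hf
    rw [hasProjectiveDimensionLT_iff_ker p hp 0,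
      ← projective_iff_hasProjectiveDimensionLT_one, ← IsProjective.iff_projective] at h₂
    have : Nontrivial (LinearMap.ker p) := nontrivial_ker_of_not_projective p hp
      (by rwa [IsProjective.iff_projective, projective_iff_hasProjectiveDimensionLT_one])
    rw [hasProjectiveDimensionLT_iff_ker q hq 0,
      ← projective_iff_hasProjectiveDimensionLT_one, ← IsProjective.iff_projective]
    exact .of_equiv (LinearEquiv.ofBijective t
      ⟨(hQ.submodule _).injective_of_surjective_of_projective t ht, ht⟩).symm
  | succ k ih =>
    obtain ⟨P, _, _, _, _, hP, p, hp⟩ := exists_uniserial_projective hR hM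
    obtain ⟨Q, _, _, _, _, hQ, q, hq, t, ht⟩ := exists_cover_ker hR hP p hp f hf
    -- `T` covers both first syzygies, so the second ones satisfy `ker g ≤ ker (t ∘ g)`: again an
    -- inclusion, with the dimension lowered by 2.
    obtain ⟨T, _, _, _, _, hT, g, hg⟩ := exists_uniserial_projective hR (hQ.submodule q.ker)
    have htg : Surjective (t ∘ₗ g) := ht.comp hg
    have key (n : ℕ) : HasProjectiveDimensionLT (ModuleCat.of R M) (n + 3) ↔
        HasProjectiveDimensionLT (ModuleCat.of R (LinearMap.ker (t ∘ₗ g))) (n + 1) := by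
      rw [hasProjectiveDimensionLT_iff_ker p hp (n + 1), hasProjectiveDimensionLT_iff_ker _ htg n]
    refine (hasProjectiveDimensionLT_iff_ker q hq (2 * k + 2)).2
      ((hasProjectiveDimensionLT_iff_ker g hg (2 * k + 1)).2 ?_)
    exact ih (hT.submodule _) (Submodule.inclusion (LinearMap.ker_le_ker_comp g t))
      (Submodule.inclusion_injective _) ((key _).1 h₂) (fun h => h₁ ((key _).2 h))

end ProjectiveDimension

/-! ### Uniseriality and finiteness of the injective envelope -/

section EssentialSimple

variable {I : Type u} [AddCommGroup I] [Module R I]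

/-- A module in which any two nonzero submodules meet is uniserial if finitely generated
indecomposable modules are uniserial. -/
theorem isUniserialModule_of_uniform
    (hR : ∀ (M : Type u) [AddCommGroup M] [Module R M] [Module.Finite R M],
      Indecomposable (ModuleCat.of R M) → IsUniserialModule R M)
    (hI : ∀ P Q : Submodule R I, P ⊓ Q = ⊥ → P = ⊥ ∨ Q = ⊥) : IsUniserialModule R I := by
  have fg (N : Submodule R I) [Module.Finite R N] : IsUniserialModule R N := by
    by_cases hN : Limits.IsZero (ModuleCat.of R N)
    · have : Subsingleton N := ModuleCat.isZero_iff_subsingleton.1 hN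
      exact fun _ _ => .inl (Subsingleton.elim _ _).le
    refine hR N ⟨hN, fun Y Z i => ?_⟩
    let e : N ≃ₗ[R] Y × Z := (i ≪≫ ModuleCat.biprodIsoProd Y Z).toLinearEquiv
    let c : Y × Z →ₗ[R] I := N.subtype ∘ₗ e.symm.toLinearMap
    have hc : Injective c := N.subtype_injective.comp e.symm.injective
    have hyz : LinearMap.range (c ∘ₗ LinearMap.inl R Y Z) ⊓
        LinearMap.range (c ∘ₗ LinearMap.inr R Y Z) = ⊥ := by
      rw [eq_bot_iff]
      rintro _ ⟨⟨y, rfl⟩, ⟨z, hz⟩⟩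
      have := hc hz
      simp only [LinearMap.inl_apply, LinearMap.inr_apply, Prod.mk.injEq] at this
      rw [← this.1, map_zero]
      exact Submodule.zero_mem (⊥ : Submodule R I)
    refine (hI _ _ hyz).imp (fun h => ?_) (fun h => ?_) <;>
      refine ModuleCat.isZero_iff_subsingleton.2 (subsingleton_of_forall_eq 0 fun y => ?_) <;>
      rw [LinearMap.range_eq_bot] at h
    · exact congr_arg Prod.fst (hc ((LinearMap.congr_fun h y).trans (map_zero c).symm))
    · exact congr_arg Prod.snd (hc ((LinearMap.congr_fun h y).trans (map_zero c).symm))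
  intro N P
  by_contra! h
  obtain ⟨x, hxN, hxP⟩ := SetLike.not_le_iff_exists.1 h.1
  obtain ⟨y, hyP, hyN⟩ := SetLike.not_le_iff_exists.1 h.2
  let F : Submodule R I := Submodule.span R {x, y}
  have : Module.Finite R F := Module.Finite.span_of_finite R (Set.toFinite _)
  have hx : x ∈ F := Submodule.subset_span (by simp)
  have hy : y ∈ F := Submodule.subset_span (by simp)
  rcases fg F (N.comap F.subtype) (P.comap F.subtype) with h | h
  · exact hxP (h (show (⟨x, hx⟩ : F) ∈ _ from hxN))
  · exact hyN (h (show (⟨y, hy⟩ : F) ∈ _ from hyP))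

/-- A uniserial module over a ring of finite length is cyclic. -/
theorem IsUniserialModule.finite [IsArtinianRing R] [IsNoetherianRing R]
    (hI : IsUniserialModule R I) : Module.Finite R I := by
  have hle (x : I) : Module.length R (R ∙ x) ≤ Module.length R R :=
    Module.length_le_of_surjective _ (LinearMap.surjective_rangeRestrict
      (LinearMap.toSpanSingleton R I x)) |>.trans' (by
        rw [LinearMap.range_toSpanSingleton])
  have htop : Module.length R R ≠ ⊤ := Module.length_ne_top
  -- Choose `x` with `R ∙ x` of maximal length; these lengths are bounded by that of `R`.
  obtain ⟨x, -, hx⟩ := (measure fun x : I =>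
    (Module.length R R).toNat - (Module.length R (R ∙ x)).toNat).wf.has_min Set.univ ⟨0, trivial⟩
  refine ⟨⟨{x}, eq_top_iff.2 fun y _ => ?_⟩⟩
  rw [Finset.coe_singleton]
  rcases hI (R ∙ y) (R ∙ x) with h | h
  · exact h (Submodule.mem_span_singleton_self y)
  by_contra hy
  have hlt : R ∙ x < R ∙ y :=
    lt_of_le_of_ne h fun h' => hy (h' ▸ Submodule.mem_span_singleton_self y)
  have h1 := Order.height_strictMono hlt
    (by rw [← Module.length_submodule]; exact (hle x).trans_lt htop.lt_top)
  rw [← Module.length_submodule, ← Module.length_submodule] at h1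
  rw [← ENat.natCast_toNat h1.ne_top, ← ENat.natCast_toNat ((hle y).trans_lt htop.lt_top).ne,
    Nat.cast_lt] at h1
  have h3 := ENat.toNat_le_toNat (hle y) htop
  exact hx y trivial (Nat.sub_lt_sub_left (h1.trans_le h3) h1)

theorem inf_eq_bot_imp_of_essential_simple {S : Submodule R I} [IsSimpleModule R S]
    (hS : IsEssentialSubmodule S) (P Q : Submodule R I) (h : P ⊓ Q = ⊥) : P = ⊥ ∨ Q = ⊥ := by
  have hatom : IsAtom S := isSimpleModule_iff_isAtom.1 ‹_›
  by_contra! hPQ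
  have hle (N : Submodule R I) (hN : N ≠ ⊥) : S ≤ N :=
    (hatom.not_disjoint_iff_le).1 fun hd => hN (hS N hd.eq_bot)
  exact hatom.1 (eq_bot_iff.2 ((le_inf (hle P hPQ.1) (hle Q hPQ.2)).trans h.le))

end EssentialSimple

/-! ### Ext into the ring, and summands of injective resolutions -/

section Ext

open Abelian

/-- Over a noetherian ring, the projective dimension `n` of a finitely generated module is
detected by `Extⁿ(-, R)`. -/
theorem hasProjectiveDimensionLT_of_subsingleton_ext [IsNoetherianRing R] {G : ModuleCat.{u} R}
    (e : G ≃ₗ[R] R) (n : ℕ) {M : Type u} [AddCommGroup M] [Module R M] [Module.Finite R M]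
    (h : HasProjectiveDimensionLT (ModuleCat.of R M) (n + 1))
    (hM : Subsingleton (Ext (ModuleCat.of R M) G n)) :
    HasProjectiveDimensionLT (ModuleCat.of R M) n := by
  induction n generalizing M with
  | zero =>
    rw [← projective_iff_hasProjectiveDimensionLT_one, ← IsProjective.iff_projective] at h
    obtain ⟨m, f, g, -, -, hfg⟩ := Module.Finite.exists_comp_eq_id_of_projective R M
    have hG : Subsingleton (ModuleCat.of R M ⟶ G) := Ext.homEquiv₀.symm.subsingleton
    have hg (x : M) : g x = 0 := by
      ext i
      have := hG.elim (ModuleCat.ofHom (e.symm.toLinearMap ∘ₗ LinearMap.proj i ∘ₗ g)) 0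
      exact e.symm.map_eq_zero_iff.1 (LinearMap.congr_fun (congr_arg ModuleCat.Hom.hom this) x)
    have : Subsingleton M := subsingleton_of_forall_eq 0 fun x => by
      rw [← LinearMap.id_apply (R := R) x, ← hfg, LinearMap.comp_apply, hg, map_zero]
    exact (ModuleCat.isZero_iff_subsingleton.2 this).hasProjectiveDimensionLT_zero
  | succ n ih =>
    obtain ⟨l, p, hp⟩ := Module.Finite.exists_fin' R M
    let S := p.shortComplexKer
    have hS : S.ShortExact := LinearMap.shortExact_shortComplexKer hp
    have hS₂ : Projective S.X₂ := (IsProjective.iff_projective (Fin l → R)).1 inferInstance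
    rw [hasProjectiveDimensionLT_iff_ker p hp n] at h
    cases n with
    | zero =>
      rw [← projective_iff_hasProjectiveDimensionLT_one, ← IsProjective.iff_projective] at h
      obtain ⟨m, f, g, -, -, hfg⟩ :=
        Module.Finite.exists_comp_eq_id_of_projective R (LinearMap.ker p)
      -- As `Ext¹(M, R) = 0`, maps from the syzygy to `R` extend to the free module. Extending the
      -- coordinates of an embedding of the projective syzygy into `Rᵐ` yields a retraction, so `M`
      -- is projective.
      have ext (a : S.X₁ ⟶ G) : ∃ b : S.X₂ ⟶ G, S.f ≫ b = a := by
        obtain ⟨b, hb⟩ := Ext.contravariant_sequence_exact₁ hS G (Ext.mk₀ a) (add_zero 1)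
          (hM.elim _ _)
        obtain ⟨b, rfl⟩ := Ext.homEquiv₀.symm.surjective b
        exact ⟨b, Ext.homEquiv₀.symm.injective (by simpa using hb)⟩
      choose b hb using fun i => ext (ModuleCat.ofHom (e.symm.toLinearMap ∘ₗ LinearMap.proj i ∘ₗ g))
      let r : S.X₂ ⟶ S.X₁ := ModuleCat.ofHom (f ∘ₗ LinearMap.pi fun i => e.toLinearMap ∘ₗ (b i).hom)
      have hr : S.f ≫ r = 𝟙 _ := by
        refine ModuleCat.hom_ext (LinearMap.ext fun x => ?_)
        have hx (i : Fin m) : e ((b i).hom (S.f.hom x)) = g x i := by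
          rw [← LinearMap.comp_apply, ← ModuleCat.hom_comp, hb i]
          exact e.apply_symm_apply _
        refine Eq.trans ?_ (LinearMap.congr_fun hfg x)
        exact congr_arg f (funext hx)
      let s := ShortComplex.Splitting.ofExactOfRetraction S hS.exact r hr hS.epi_g
      exact (Retract.mk s.s S.g s.s_g).hasProjectiveDimensionLT 1
    | succ n =>
      rw [hasProjectiveDimensionLT_iff_ker p hp n]
      refine ih h ⟨fun a b => ?_⟩
      have zero (a : Ext S.X₁ G (n + 1)) : a = 0 := by
        obtain ⟨c, rfl⟩ := Ext.contravariant_sequence_exact₁ hS G a (add_comm _ _) (hM.elim _ _)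
        rw [Ext.eq_zero_of_projective c, Ext.comp_zero]
      exact (zero a).trans (zero b).symm

/-- If `Extⁱ(S, M) ≠ 0` for a simple module `S`, then the injective envelope of `S` is a direct
summand of the `i`-th term of any injective resolution of `M`. -/
theorem nonempty_retract_of_nontrivial_ext {S I M : ModuleCat.{u} R} [IsSimpleModule R S]
    {ι : S ⟶ I} (hι : IsInjectiveEnvelope ι) (Q : InjectiveResolution M) (i : ℕ)
    (h : Nontrivial (Ext S M i)) : Nonempty (Retract I (Q.cocomplex.X i)) := by
  have := hι.injective
  have := hι.mono
  obtain ⟨x, hx⟩ := exists_ne (0 : Ext S M i)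
  -- A nonzero class is represented by a nonzero, hence injective, map from `S`. Its extension to
  -- `I` is injective by essentiality, and splits because `I` is injective.
  obtain ⟨f, hf, rfl⟩ := Q.extMk_surjective x (i + 1) rfl
  have hf0 : f.hom ≠ 0 := by
    intro h0
    obtain rfl : f = 0 := ModuleCat.hom_ext h0
    exact hx (Q.extMk_zero _ rfl)
  have hfi : Injective f.hom := (LinearMap.injective_or_eq_zero f.hom).resolve_right hf0
  have hfac : ι ≫ Injective.factorThru f ι = f := Injective.comp_factorThru f ι
  let g := Injective.factorThru f ι
  have hker : LinearMap.ker g.hom = ⊥ := by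
    refine hι.essential _ (eq_bot_iff.2 ?_)
    rintro _ ⟨⟨s, rfl⟩, hs⟩
    have : f.hom s = 0 := by rw [← hfac]; exact hs
    rw [(map_eq_zero_iff _ hfi).1 this, map_zero]
    exact Submodule.zero_mem _
  have : Mono g := (ModuleCat.mono_iff_ker_eq_bot g).2 hker
  exact ⟨⟨g, Injective.factorThru (𝟙 I) g, Injective.comp_factorThru _ _⟩⟩

end Ext

/-! ### The main theorem -/

/-- The regular right module, as a module over the opposite ring. -/
def regularRightModuleEquiv (A : Type u) [Ring A] : regularRightModule A ≃ₗ[Aᵐᵒᵖ] Aᵐᵒᵖ where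
  __ := (MulOpposite.opAddEquiv : A ≃+ Aᵐᵒᵖ)
  map_smul' _ _ := rfl

theorem mainTheorem10 {K : Type*} [Field K] {A : Type u} [Ring A] [Algebra K A]
    [FiniteDimensional K A] (hN : IsNakayama A) (hAG : IsAuslanderGorenstein A)
    (S I : ModuleCat.{u} Aᵐᵒᵖ) [IsSimpleModule Aᵐᵒᵖ S] (ι : S ⟶ I) (hι : IsInjectiveEnvelope ι)
    (hodd : ∃ d : ℕ, Odd d ∧ projectiveDimension I = (d : WithBot ℕ∞)) :
    projectiveDimension I = projectiveDimension S ∧ IsPerfectModule S := by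
  obtain ⟨_, ⟨k, rfl⟩, hd⟩ := hodd
  have : Module.Finite K Aᵐᵒᵖ := .equiv (MulOpposite.opLinearEquiv K)
  have : IsNoetherianRing Aᵐᵒᵖ := isNoetherian_of_tower K inferInstance
  have : IsArtinianRing Aᵐᵒᵖ := isArtinian_of_tower K inferInstance
  have : Module.Finite Aᵐᵒᵖ S := inferInstance
  have := hι.mono
  have hιi : Injective ι.hom := (ModuleCat.mono_iff_injective ι).1 inferInstance
  have hgrade (i : ℕ) (hi : Nontrivial (Abelian.Ext S (regularRightModule A) i)) :
      2 * k + 1 ≤ i := by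
    obtain ⟨Q, -, hQ⟩ := hAG.isNGorenstein (i + 1) (by omega)
    obtain ⟨r⟩ := nonempty_retract_of_nontrivial_ext hι Q i hi
    have := (r.projectiveDimension_le).trans (hQ i (Nat.lt_succ_self i))
    rw [hd] at this
    exact_mod_cast this
  have hSι : IsSimpleModule Aᵐᵒᵖ (LinearMap.range ι.hom) :=
    .congr (LinearEquiv.ofInjective ι.hom hιi).symm
  have hIu : IsUniserialModule Aᵐᵒᵖ I := isUniserialModule_of_uniform hN.right
    (inf_eq_bot_imp_of_essential_simple hι.essential)
  have := hIu.finite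
  have hS : HasProjectiveDimensionLT S (2 * k + 2) :=
    hIu.hasProjectiveDimensionLT_of_injective hN.right k ι.hom hιi
      (projectiveDimension_lt_iff.1 (by rw [hd]; exact_mod_cast Nat.lt_succ_self _))
      (fun h => (projectiveDimension_lt_iff.2 h).ne hd)
  have hsub (n : ℕ) (hn : n < 2 * k + 1) :
      Subsingleton (Abelian.Ext S (regularRightModule A) n) := by
    rw [← not_nontrivial_iff_subsingleton]
    exact fun h => (hgrade n h).not_gt hn
  have detect (n : ℕ) (h : HasProjectiveDimensionLT S (n + 1))
      (h' : Subsingleton (Abelian.Ext S (regularRightModule A) n)) :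
      HasProjectiveDimensionLT S n :=
    hasProjectiveDimensionLT_of_subsingleton_ext (G := regularRightModule A)
      (regularRightModuleEquiv A) n h h'
  have hS' : ¬ HasProjectiveDimensionLT S (2 * k + 1) := by
    -- Below degree `2k + 1` all `Ext` groups vanish, so a smaller bound would descend to 0, giving
    -- `S = 0`.
    have (n : ℕ) (hn : n ≤ 2 * k + 1) : ¬ HasProjectiveDimensionLT S n := by
      induction n with
      | zero =>
        rw [hasProjectiveDimensionLT_zero_iff_isZero, ModuleCat.isZero_iff_subsingleton,
          not_subsingleton_iff_nontrivial]
        exact IsSimpleModule.nontrivial Aᵐᵒᵖ S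
      | succ n ih => exact fun h => ih (by omega) (detect n h (hsub n hn))
    exact this _ le_rfl
  have hpd : projectiveDimension S = (2 * k + 1 : ℕ) :=
    le_antisymm ((projectiveDimension_le_iff S _).2 hS) ((projectiveDimension_ge_iff S _).2 hS')
  refine ⟨hd.trans hpd.symm, ?_⟩
  have hg : moduleGrade S = (2 * k + 1 : ℕ) := by
    refine le_antisymm (iInf₂_le (2 * k + 1) ?_) (le_iInf₂ fun i hi => ?_)
    · rw [← not_subsingleton_iff_nontrivial]
      exact fun h => hS' (detect _ hS h)
    · exact_mod_cast hgrade i hi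
  rw [IsPerfectModule, hg, hpd]
  rfl
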